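/- Let $X\subseteq\mathbb{R}^d$ be open and connected, and let $p,q$ be probability densities on $\mathbb{R}^d$ (with respect to Lebesgue measure) that are supported on $X$: each is strictly positive and differentiable on $X$, vanishes outside $X$, and is continuous on $\mathbb{R}^d$ (so it tends to zero at the border of $X$). Let $\mathcal{F}$ be a reproducing kernel Hilbert space of real-valued functions on $\mathbb{R}^d$ with kernel $k$, such that for every $i$ the mixed partial derivative $\partial^2 k(x,y)/\partial x_i\partial y_i$ exists everywhere and is continuous. Let $\mathcal{F}^d$ be the product Hilbert space with $\langle f,g\rangle_{\mathcal{F}^d}=\sum_{i=1}^d\langle f_i,g_i\rangle_{\mathcal{F}}$. For $f\in\mathcal{F}^d$ let $$(T_pf)(x)=\sum_{i=1}^d\left(\frac{\partial\log p(x)}{\partial x_i}f_i(x)+\frac{\partial f_i(x)}{\partial x_i}\right),$$ and for $Z\sim q$, $X_0\sim p$ define the Stein discrepancy $$S_p(Z)=\sup_{f\in\mathcal{F}^d,\ \|f\|<1}\Big(\mathbb{E}_q(T_pf)(Z)-\mathbb{E}_p(T_pf)(X_0)\Big),$$ where $\mathbb{E}_p(T_pf)(X_0)$ is read as $0$, the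 value given by Stein's identity, if $T_pf$ is not $p$-integrable. Let $$h_q(x,y)=\nabla\log q(x)^\top\nabla\log q(y)\,k(x,y)+\nabla\log q(y)^\top\nabla_xk(x,y)+\nabla\log q(x)^\top\nabla_yk(x,y)+\sum_{i=1}^d\frac{\partial^2k(x,y)}{\partial x_i\partial y_i}.$$ Assume that $k$ is $C_0$-universal, that is, every element of $\mathcal{F}$ is continuous and vanishes at infinity, and $\mathcal{F}$ is dense in $L^2(\mathbb{R}^d,\mu)$ for every Borel probability measure $\mu$. Assume also that $\mathbb{E}_q h_q(Z,Z)<\infty$ and $\mathbb{E}_q\left\|\nabla\left(\log\frac{p(Z)}{q(Z)}\right)\right\|^2<\infty$. Then $S_p(Z)=0$ if and only if $p=q$. -/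

import Mathlib

open MeasureTheory Filter Topology
open scoped ENNReal

namespace KernelStein

noncomputable section

/-- The partial derivative `∂g/∂xᵢ` at `x` of a real function `g` on `ℝᵈ`. -/
def partialDeriv {d : ℕ} (i : Fin d) (g : EuclideanSpace ℝ (Fin d) → ℝ)
    (x : EuclideanSpace ℝ (Fin d)) : ℝ :=
  lineDeriv ℝ g x (EuclideanSpace.single i 1)

/-- The partial derivative `∂g/∂xᵢ` exists at `x`. -/
def HasPartial {d : ℕ} (i : Fin d) (g : EuclideanSpace ℝ (Fin d) → ℝ)
    (x : EuclideanSpace ℝ (Fin d)) : Prop :=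
  LineDifferentiableAt ℝ g x (EuclideanSpace.single i 1)

/-- The gradient `∇g = (∂g/∂x₁, …, ∂g/∂x_d)`. -/
def grad {d : ℕ} (g : EuclideanSpace ℝ (Fin d) → ℝ)
    (x : EuclideanSpace ℝ (Fin d)) : EuclideanSpace ℝ (Fin d) :=
  WithLp.toLp 2 fun i => partialDeriv i g x

/-- `p` is (the density of) a probability measure supported on the set `X`: `p` is strictly
positive on `X` and zero elsewhere, it goes continuously to zero at the border of `X`, it is
differentiable on `X`, and it integrates to one. -/
structure IsDensityOn {d : ℕ} (X : Set (EuclideanSpace ℝ (Fin d)))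
    (p : EuclideanSpace ℝ (Fin d) → ℝ) : Prop where
  pos : ∀ x ∈ X, 0 < p x
  eq_zero : ∀ x ∉ X, p x = 0
  continuous : Continuous p
  differentiableOn : DifferentiableOn ℝ p X
  integral_eq_one : ∫ x, p x = 1

/-- The measure on `ℝᵈ` with Lebesgue density `p`. -/
def law {d : ℕ} (p : EuclideanSpace ℝ (Fin d) → ℝ) : Measure (EuclideanSpace ℝ (Fin d)) :=
  volume.withDensity fun x => ENNReal.ofReal (p x)

/-- The reproducing kernel `k : X × X → ℝ` of a reproducing kernel Hilbert space `F` of real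
functions on `X`. -/
def ker {X : Type*} (F : Type*) [NormedAddCommGroup F] [InnerProductSpace ℝ F] [CompleteSpace F]
    [RKHS ℝ F X ℝ] (x y : X) : ℝ :=
  RKHS.kernel F x y 1

/-- The kernel of `F` is `C₀`-universal: `F` consists of continuous functions that vanish at
infinity, and `F` is dense in `L²(μ)` for every probability measure `μ`. -/
structure IsC0Universal {X : Type*} [TopologicalSpace X] [MeasurableSpace X] (F : Type*)
    [NormedAddCommGroup F] [InnerProductSpace ℝ F] [RKHS ℝ F X ℝ] : Prop where
  continuous : ∀ f : F, Continuous (f : X → ℝ)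
  vanish : ∀ f : F, Tendsto (f : X → ℝ) (cocompact X) (𝓝 0)
  dense : ∀ μ : Measure X, IsProbabilityMeasure μ → ∀ g : X → ℝ, MemLp g 2 μ →
    ∀ ε : ℝ≥0∞, 0 < ε → ∃ f : F, eLpNorm (fun x => g x - f x) 2 μ < ε

/-- The kernel `k(x, y)` is once continuously differentiable: for each `i` the mixed partial
derivative `∂²k/∂xᵢ∂yᵢ` exists everywhere and is continuous. -/
def IsC1Kernel {d : ℕ} (k : EuclideanSpace ℝ (Fin d) → EuclideanSpace ℝ (Fin d) → ℝ) : Prop :=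
  ∀ i : Fin d,
    (∀ x y, HasPartial i (fun y' => k x y') y) ∧
    (∀ x y, HasPartial i (fun x' => partialDeriv i (fun y' => k x' y') y) x) ∧
    Continuous fun z : EuclideanSpace ℝ (Fin d) × EuclideanSpace ℝ (Fin d) =>
      partialDeriv i (fun x' => partialDeriv i (fun y' => k x' y') z.2) z.1

/-- The Stein operator
`(T_p f)(x) = ∑ᵢ (∂ log p(x)/∂xᵢ · fᵢ(x) + ∂fᵢ(x)/∂xᵢ)` for `f = (f₁, …, f_d)` in `Fᵈ`. -/
def steinOp {d : ℕ} {F : Type*} [NormedAddCommGroup F] [InnerProductSpace ℝ F]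
    [RKHS ℝ F (EuclideanSpace ℝ (Fin d)) ℝ] (p : EuclideanSpace ℝ (Fin d) → ℝ)
    (f : PiLp 2 fun _ : Fin d => F) (x : EuclideanSpace ℝ (Fin d)) : ℝ :=
  ∑ i : Fin d,
    (partialDeriv i (fun y => Real.log (p y)) x * f i x + partialDeriv i (fun y => f i y) x)

/-- The Stein discrepancy
`S_p(Z) = sup_{‖f‖ < 1} (E_q (T_p f)(Z) - E_p (T_p f)(X))`, `Z ∼ q`, `X ∼ p`, where `f` runs over
the open unit ball of the product space `Fᵈ`. -/
def steinDiscrepancy {d : ℕ} (F : Type*) [NormedAddCommGroup F] [InnerProductSpace ℝ F]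
    [RKHS ℝ F (EuclideanSpace ℝ (Fin d)) ℝ] (p q : EuclideanSpace ℝ (Fin d) → ℝ) : EReal :=
  ⨆ f ∈ Metric.ball (0 : PiLp 2 fun _ : Fin d => F) 1,
    (((∫ z, steinOp p f z ∂(law q)) - ∫ x, steinOp p f x ∂(law p) : ℝ) : EReal)

/-- The Stein kernel `h_p(x, y)` built from a density `p` and a kernel `k`. -/
def steinKernel {d : ℕ} (k : EuclideanSpace ℝ (Fin d) → EuclideanSpace ℝ (Fin d) → ℝ)
    (p : EuclideanSpace ℝ (Fin d) → ℝ) (x y : EuclideanSpace ℝ (Fin d)) : ℝ :=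
  inner ℝ (grad (fun z => Real.log (p z)) x) (grad (fun z => Real.log (p z)) y) * k x y
    + inner ℝ (grad (fun z => Real.log (p z)) y) (grad (fun x' => k x' y) x)
    + inner ℝ (grad (fun z => Real.log (p z)) x) (grad (fun y' => k x y') y)
    + ∑ i : Fin d, partialDeriv i (fun x' => partialDeriv i (fun y' => k x' y') y) x

end

end KernelStein

/-!
The equality `p = q` trivially makes the discrepancy vanish. For the converse it is enough to test
the Stein operator on fields `f = g eᵢ` with a single nonzero component.

* Since the mixed partial derivatives of the kernel are continuous, the difference quotients of the
  feature map `x ↦ k(x, ·)` are Cauchy in `F`. The limit `derivFeature` represents `g ↦ ∂ᵢ g(x)`, so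
  that the elements of `F` have continuous partial derivatives, and `h_q(x, x)` is the squared norm
  of the element of `Fᵈ` representing `f ↦ (T_q f)(x)`. Hence `T_q f` is integrable under `q`.
* Stein's identity `∫ ∂ᵢ(p g) = 0` holds as soon as its integrand is integrable
  (`IsDensityOn.integral_stein_eq_zero`), without regularity of the boundary of `X` or of the
  derivative of `p`. Integration by parts is applied to `φ(p) χ g`, where `χ` is a cutoff at
  infinity and `φ(t) = max (t - ε) 0 ^ 2 / t`. Its derivative is `φ'(p) χ ∂ᵢ(p g)` plus two error
  terms, in which no derivative of `p` appears because `φ'(p) g ∂ᵢp` is rewritten by means of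
  `∂ᵢ(p g)`. They are of order `ε` (since `|φ(t) - t φ'(t)| ≤ 2 ε`) and `1 / R`.
* If the discrepancy is zero, then `E_q T_p f = 0` for all `f`. Subtracting `E_q T_q f = 0` shows
  that `∂ᵢ log (p / q)` is orthogonal to `F` in `L²(q)`, hence zero almost everywhere on `X` by
  universality.
* The function `log (p / q)` is differentiable at every point of `X`, and its derivative vanishes
  almost everywhere. By Fubini and the fundamental theorem of calculus on almost every line it is
  locally constant (`fderiv_eq_zero_of_ae`). As `X` is connected, `p` is a multiple of `q`, and the
  factor is one because both integrate to one.
-/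

namespace KernelStein

noncomputable section

/-! ### Line derivatives -/

/-- Mean value theorem along the line through `x` in direction `v`. -/
lemma exists_sub_eq_mul_lineDeriv {E : Type*} [AddCommGroup E] [Module ℝ E]
    {g : E → ℝ} {v : E} (hg : ∀ y, LineDifferentiableAt ℝ g y v) (x : E) (t : ℝ) :
    ∃ θ ∈ Set.Ioo (0 : ℝ) 1, g (x + t • v) - g x = t * lineDeriv ℝ g (x + (θ * t) • v) v := by
  have hd : ∀ s : ℝ, HasDerivAt (fun r : ℝ => g (x + (r * t) • v))
      (t * lineDeriv ℝ g (x + (s * t) • v) v) s := by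
    intro s
    have h1 : HasDerivAt (fun r : ℝ => g (x + (s * t) • v + r • v))
        (lineDeriv ℝ g (x + (s * t) • v) v) ((s - s) * t) := by
      rw [sub_self, zero_mul]
      exact (hg (x + (s * t) • v)).hasLineDerivAt
    have h2 : HasDerivAt (fun r : ℝ => (r - s) * t) (1 * t) s :=
      ((hasDerivAt_id s).sub_const s).mul_const t
    have h3 := h1.comp s h2
    rw [one_mul, mul_comm (lineDeriv ℝ g (x + (s * t) • v) v)] at h3
    refine h3.congr_of_eventuallyEq (Eventually.of_forall fun r => ?_)
    simp only [Function.comp_apply, add_assoc, ← add_smul]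
    congr 3
    ring
  obtain ⟨θ, hθ, h⟩ := exists_hasDerivAt_eq_slope (fun r : ℝ => g (x + (r * t) • v)) _ one_pos
    (fun s _ => (hd s).continuousAt.continuousWithinAt) (fun s _ => hd s)
  refine ⟨θ, hθ, ?_⟩
  rw [h]
  simp

/-! ### Derivatives in a reproducing kernel Hilbert space -/

section RKHS

variable {d : ℕ} {F : Type*} [NormedAddCommGroup F] [InnerProductSpace ℝ F]
  [RKHS ℝ F (EuclideanSpace ℝ (Fin d)) ℝ]

lemma IsC0Universal.exists_abs_le (hu : IsC0Universal (X := EuclideanSpace ℝ (Fin d)) F) (f : F) :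
    ∃ M, ∀ x : EuclideanSpace ℝ (Fin d), |f x| ≤ M := by
  let g : ZeroAtInftyContinuousMap (EuclideanSpace ℝ (Fin d)) ℝ :=
    ⟨⟨f, hu.continuous f⟩, hu.vanish f⟩
  exact ⟨‖g.toBCF‖, fun x => g.toBCF.norm_coe_le_norm x⟩

variable [CompleteSpace F]

/-- The feature `k(x, ·)`, the element of `F` that represents evaluation at `x`. -/
def feature (F : Type*) [NormedAddCommGroup F] [InnerProductSpace ℝ F] [CompleteSpace F]
    {X : Type*} [RKHS ℝ F X ℝ] (x : X) : F :=
  RKHS.kerFun F x 1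

lemma inner_feature (x : EuclideanSpace ℝ (Fin d)) (f : F) : inner ℝ (feature F x) f = f x := by
  simp [feature]

lemma ker_eq_inner (x y : EuclideanSpace ℝ (Fin d)) :
    ker F x y = inner ℝ (feature F x) (feature F y) := by
  rw [inner_feature, feature, RKHS.kerFun_apply, ker]

/-- The inner product of two difference quotients of the feature map in direction `i` is a value
of the mixed partial derivative of the kernel at a nearby point. -/
lemma exists_inner_sub_feature_eq (hk : IsC1Kernel (ker F)) (i : Fin d)
    (x : EuclideanSpace ℝ (Fin d)) (s t : ℝ) :
    ∃ a ∈ Set.Ioo (0 : ℝ) 1, ∃ b ∈ Set.Ioo (0 : ℝ) 1,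
      inner ℝ (feature F (x + s • EuclideanSpace.single i 1) - feature F x)
        (feature F (x + t • EuclideanSpace.single i 1) - feature F x) =
      s * t * partialDeriv i (fun x' => partialDeriv i (fun y' => ker F x' y')
        (x + (b * t) • EuclideanSpace.single i 1)) (x + (a * s) • EuclideanSpace.single i 1) := by
  set e : EuclideanSpace ℝ (Fin d) := EuclideanSpace.single i 1
  obtain ⟨h1, h2, -⟩ := hk i
  -- The two existence assumptions dictate the order: difference in `y` first, then in `x`.
  have hH : ∀ y, HasLineDerivAt ℝ (fun y => ker F (x + s • e) y - ker F x y)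
      (partialDeriv i (fun y' => ker F (x + s • e) y') y
        - partialDeriv i (fun y' => ker F x y') y) y e := fun y =>
    HasDerivAt.sub (h1 (x + s • e) y).hasLineDerivAt (h1 x y).hasLineDerivAt
  obtain ⟨b, hb, hbe⟩ := exists_sub_eq_mul_lineDeriv (fun y => (hH y).lineDifferentiableAt) x t
  rw [(hH _).lineDeriv] at hbe
  obtain ⟨a, ha, hae⟩ := exists_sub_eq_mul_lineDeriv
    (fun x' => h2 x' (x + (b * t) • e)) x s
  refine ⟨a, ha, b, hb, ?_⟩
  rw [hae] at hbe
  simp only [inner_sub_left, inner_sub_right, ← ker_eq_inner]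
  rw [partialDeriv]
  linarith

/-- The feature map has a partial derivative `D` in `F`, which represents the partial derivative
of the elements of `F`. -/
lemma exists_derivFeature (hk : IsC1Kernel (ker F)) (i : Fin d) :
    ∃ D : EuclideanSpace ℝ (Fin d) → F, ∀ (f : F) (x : EuclideanSpace ℝ (Fin d)),
      HasLineDerivAt ℝ (f : EuclideanSpace ℝ (Fin d) → ℝ) (inner ℝ (D x) f) x
        (EuclideanSpace.single i 1) := by
  set e : EuclideanSpace ℝ (Fin d) := EuclideanSpace.single i 1 with he
  suffices h : ∀ x, ∃ D : F, Tendsto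
      (fun t : ℝ => t⁻¹ • (feature F (x + t • e) - feature F x)) (𝓝[≠] 0) (𝓝 D) by
    choose D hD using h
    refine ⟨D, fun f x => ?_⟩
    rw [hasLineDerivAt_iff_tendsto_slope_zero]
    refine ((hD x).inner tendsto_const_nhds).congr fun t => ?_
    rw [inner_smul_left, inner_sub_left, inner_feature, inner_feature]
    simp
  intro x
  refine cauchy_map_iff_exists_tendsto.1 ?_
  rw [Metric.cauchy_iff]
  refine ⟨inferInstance, fun ε hε => ?_⟩
  set M : EuclideanSpace ℝ (Fin d) → EuclideanSpace ℝ (Fin d) → ℝ := fun x y =>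
    partialDeriv i (fun x' => partialDeriv i (fun y' => ker F x' y') y) x with hM
  set Q : ℝ → F := fun t => t⁻¹ • (feature F (x + t • e) - feature F x) with hQ
  have hMc : ContinuousAt (fun z : ℝ × ℝ => M (x + z.1 • e) (x + z.2 • e)) (0, 0) := by
    have := (hk i).2.2
    have h3 : Continuous fun z : ℝ × ℝ => (x + z.1 • e, x + z.2 • e) := by fun_prop
    exact (this.comp h3).continuousAt
  have hε4 : 0 < ε ^ 2 / 4 := by positivity
  obtain ⟨δ, hδ, hMδ⟩ := Metric.continuousAt_iff.1 hMc _ hε4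
  have key : ∀ s t : ℝ, s ≠ 0 → t ≠ 0 → |s| < δ → |t| < δ →
      |inner ℝ (Q s) (Q t) - M x x| < ε ^ 2 / 4 := by
    intro s t hs ht hsδ htδ
    obtain ⟨a, ha, b, hb, hab⟩ := exists_inner_sub_feature_eq hk i x s t
    have h4 : inner ℝ (Q s) (Q t) = M (x + (a * s) • e) (x + (b * t) • e) := by
      rw [← he] at hab
      simp only [hQ, inner_smul_left, inner_smul_right, hab, hM, conj_trivial]
      field_simp
    have hlt : ∀ a s : ℝ, a ∈ Set.Ioo (0 : ℝ) 1 → |s| < δ → |a * s| < δ := by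
      intro a s ha hs
      rw [abs_mul, abs_of_pos ha.1]
      nlinarith [ha.1, ha.2, abs_nonneg s]
    have := @hMδ (a * s, b * t) (by
      rw [Prod.dist_eq, Real.dist_eq, Real.dist_eq, sub_zero, sub_zero]
      exact max_lt (hlt a s ha hsδ) (hlt b t hb htδ))
    rw [h4]
    simpa [Real.dist_eq] using this
  refine ⟨Q '' (Metric.ball 0 δ \ {0}), image_mem_map
    (sdiff_mem_nhdsWithin_compl (Metric.ball_mem_nhds 0 hδ) _), ?_⟩
  rintro _ ⟨s, ⟨hs, hs0⟩, rfl⟩ _ ⟨t, ⟨ht, ht0⟩, rfl⟩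
  rw [Metric.mem_ball, Real.dist_eq, sub_zero] at hs ht
  have e1 := abs_lt.1 (key s s hs0 hs0 hs hs)
  have e2 := abs_lt.1 (key s t hs0 ht0 hs ht)
  have e3 := abs_lt.1 (key t t ht0 ht0 ht ht)
  rw [dist_eq_norm]
  refine lt_of_pow_lt_pow_left₀ 2 hε.le ?_
  rw [@norm_sub_sq_real, ← real_inner_self_eq_norm_sq, ← real_inner_self_eq_norm_sq]
  linarith [e1.2, e2.1, e3.2]

/-- The partial derivative `∂ᵢ k(x, ·)` of the feature map of `F` at `x`, as an element of `F`. -/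
def derivFeature (hk : IsC1Kernel (ker F)) (i : Fin d) : EuclideanSpace ℝ (Fin d) → F :=
  (exists_derivFeature hk i).choose

lemma hasLineDerivAt_derivFeature (hk : IsC1Kernel (ker F)) (i : Fin d) (f : F)
    (x : EuclideanSpace ℝ (Fin d)) :
    HasLineDerivAt ℝ (f : EuclideanSpace ℝ (Fin d) → ℝ) (inner ℝ (derivFeature hk i x) f) x
      (EuclideanSpace.single i 1) :=
  (exists_derivFeature hk i).choose_spec f x

lemma partialDeriv_coe (hk : IsC1Kernel (ker F)) (i : Fin d) (f : F)
    (x : EuclideanSpace ℝ (Fin d)) :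
    partialDeriv i (fun y => f y) x = inner ℝ (derivFeature hk i x) f :=
  (hasLineDerivAt_derivFeature hk i f x).lineDeriv

lemma partialDeriv_ker_right (hk : IsC1Kernel (ker F)) (i : Fin d)
    (x y : EuclideanSpace ℝ (Fin d)) :
    partialDeriv i (fun y' => ker F x y') y = inner ℝ (derivFeature hk i y) (feature F x) := by
  rw [← partialDeriv_coe]
  congr 1
  ext y'
  rw [ker_eq_inner, real_inner_comm, inner_feature]

lemma partialDeriv_ker_left (hk : IsC1Kernel (ker F)) (i : Fin d)
    (x y : EuclideanSpace ℝ (Fin d)) :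
    partialDeriv i (fun x' => ker F x' y) x = inner ℝ (derivFeature hk i x) (feature F y) := by
  rw [← partialDeriv_coe]
  congr 1
  ext x'
  rw [ker_eq_inner, inner_feature]

lemma partialDeriv_partialDeriv_ker (hk : IsC1Kernel (ker F)) (i : Fin d)
    (x y : EuclideanSpace ℝ (Fin d)) :
    partialDeriv i (fun x' => partialDeriv i (fun y' => ker F x' y') y) x =
      inner ℝ (derivFeature hk i x) (derivFeature hk i y) := by
  rw [← partialDeriv_coe]
  congr 1
  ext x'
  rw [partialDeriv_ker_right hk, real_inner_comm, inner_feature]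

lemma continuous_derivFeature (hk : IsC1Kernel (ker F)) (i : Fin d) :
    Continuous (derivFeature hk i) := by
  have hc := (hk i).2.2
  simp only [partialDeriv_partialDeriv_ker hk] at hc
  refine continuous_iff_continuousAt.2 fun x => ?_
  rw [ContinuousAt, tendsto_iff_norm_sub_tendsto_zero]
  have h1 : Continuous fun y => ‖derivFeature hk i y - derivFeature hk i x‖ ^ 2 := by
    have e : ∀ y, ‖derivFeature hk i y - derivFeature hk i x‖ ^ 2 =
        inner ℝ (derivFeature hk i y) (derivFeature hk i y)
        - 2 * inner ℝ (derivFeature hk i y) (derivFeature hk i x)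
        + inner ℝ (derivFeature hk i x) (derivFeature hk i x) := by
      intro y
      rw [@norm_sub_sq_real, ← real_inner_self_eq_norm_sq, ← real_inner_self_eq_norm_sq]
    simp only [e]
    have a1 : Continuous fun y : EuclideanSpace ℝ (Fin d) => (y, y) := by fun_prop
    have a2 : Continuous fun y : EuclideanSpace ℝ (Fin d) => (y, x) := by fun_prop
    exact ((hc.comp a1).sub (continuous_const.mul (hc.comp a2))).add continuous_const
  have h2 := (h1.sqrt).tendsto x
  simpa using h2

/-- On the diagonal the Stein kernel is the squared norm of the element of `Fᵈ` that represents
the Stein operator. -/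
lemma steinKernel_self (hk : IsC1Kernel (ker F)) (p : EuclideanSpace ℝ (Fin d) → ℝ)
    (x : EuclideanSpace ℝ (Fin d)) :
    steinKernel (ker F) p x x = ∑ i, ‖partialDeriv i (fun y => Real.log (p y)) x • feature F x
      + derivFeature hk i x‖ ^ 2 := by
  simp only [steinKernel, partialDeriv_partialDeriv_ker hk]
  simp only [grad, PiLp.inner_apply, partialDeriv_ker_left hk, partialDeriv_ker_right hk,
    Finset.sum_mul, ← Finset.sum_add_distrib]
  refine Finset.sum_congr rfl fun i _ => ?_
  rw [@norm_add_sq_real, ← real_inner_self_eq_norm_sq, ← real_inner_self_eq_norm_sq,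
    inner_smul_left, inner_smul_left, inner_smul_right, ker_eq_inner,
    real_inner_comm (derivFeature hk i x) (feature F x)]
  simp
  ring

end RKHS

/-! ### Cutoff functions -/

lemma hasDerivAt_max_zero_sq (t : ℝ) : HasDerivAt (fun s : ℝ => max s 0 ^ 2) (2 * max t 0) t := by
  rcases lt_trichotomy t 0 with h | rfl | h
  · rw [max_eq_right h.le, mul_zero]
    refine (hasDerivAt_const t (0 : ℝ)).congr_of_eventuallyEq ?_
    filter_upwards [eventually_lt_nhds h] with s hs
    simp [max_eq_right hs.le]
  · rw [max_self, mul_zero, hasDerivAt_iff_isLittleO_nhds_zero]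
    refine Asymptotics.IsBigO.trans_isLittleO (g := fun h : ℝ => h ^ 2) ?_ ?_
    · refine Asymptotics.isBigO_of_le _ fun h => ?_
      simp only [zero_add, max_self, smul_zero, sub_zero, norm_pow]
      norm_num
      rcases le_total h 0 with hh | hh
      · simp [max_eq_right hh, sq_nonneg]
      · simp [max_eq_left hh]
    · simpa using Asymptotics.isLittleO_pow_id one_lt_two
  · rw [max_eq_left h.le]
    have h1 : HasDerivAt (fun s : ℝ => s ^ 2) (2 * t) t := by simpa using hasDerivAt_pow 2 t
    refine h1.congr_of_eventuallyEq ?_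
    filter_upwards [eventually_gt_nhds h] with s hs
    simp [max_eq_left hs.le]

/-- A continuously differentiable approximation `max (t - ε) 0 ^ 2 / t` of `t ↦ t` on `[0, ∞)`
that vanishes on `[0, ε]`. -/
def lowCut (ε t : ℝ) : ℝ := max (t - ε) 0 ^ 2 / t

/-- The derivative of `lowCut ε` on `(0, ∞)`. -/
def lowCutDeriv (ε t : ℝ) : ℝ := max (t - ε) 0 * (2 * t - max (t - ε) 0) / t ^ 2

lemma hasDerivAt_lowCut (ε : ℝ) {t : ℝ} (ht : 0 < t) :
    HasDerivAt (lowCut ε) (lowCutDeriv ε t) t := by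
  have h1 : HasDerivAt (fun s : ℝ => max (s - ε) 0 ^ 2) (2 * max (t - ε) 0) t := by
    have h := (hasDerivAt_max_zero_sq (t - ε)).comp t ((hasDerivAt_id t).sub_const ε)
    rwa [mul_one] at h
  refine (h1.div (hasDerivAt_id t) ht.ne').congr_deriv ?_
  simp only [lowCutDeriv, id]
  ring

lemma measurable_lowCut (ε : ℝ) : Measurable (lowCut ε) := by
  unfold lowCut; fun_prop

lemma measurable_lowCutDeriv (ε : ℝ) : Measurable (lowCutDeriv ε) := by
  unfold lowCutDeriv; fun_prop

lemma lowCut_eq_zero {ε t : ℝ} (h : t ≤ ε) : lowCut ε t = 0 := by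
  simp [lowCut, max_eq_right (sub_nonpos.2 h)]

lemma lowCutDeriv_eq_zero {ε t : ℝ} (h : t ≤ ε) : lowCutDeriv ε t = 0 := by
  simp [lowCutDeriv, max_eq_right (sub_nonpos.2 h)]

lemma abs_lowCut_le {ε t : ℝ} (hε : 0 < ε) (ht : 0 ≤ t) : |lowCut ε t| ≤ t := by
  rcases le_or_gt t ε with h | h
  · simpa [lowCut_eq_zero h] using ht
  · have ht0 : 0 < t := hε.trans h
    rw [lowCut, max_eq_left (sub_nonneg.2 h.le), abs_of_nonneg (by positivity), div_le_iff₀ ht0]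
    nlinarith

lemma abs_lowCutDeriv_le {ε t : ℝ} (hε : 0 < ε) : |lowCutDeriv ε t| ≤ 1 := by
  rcases le_or_gt t ε with h | h
  · simp [lowCutDeriv_eq_zero h]
  · have ht0 : 0 < t := hε.trans h
    rw [lowCutDeriv, max_eq_left (sub_nonneg.2 h.le), abs_of_nonneg
      (div_nonneg (mul_nonneg (by linarith) (by linarith)) (sq_nonneg t)),
      div_le_one (by positivity)]
    nlinarith

lemma abs_lowCut_sub_le {ε t : ℝ} (hε : 0 < ε) :
    |lowCut ε t - t * lowCutDeriv ε t| ≤ 2 * ε := by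
  rcases le_or_gt t ε with h | h
  · simpa [lowCut_eq_zero h, lowCutDeriv_eq_zero h] using hε.le
  · have ht0 : 0 < t := hε.trans h
    have e : lowCut ε t - t * lowCutDeriv ε t = -(2 * ε * (t - ε) / t) := by
      rw [lowCut, lowCutDeriv, max_eq_left (sub_nonneg.2 h.le)]
      field_simp
      ring
    rw [e, abs_neg, abs_of_nonneg (div_nonneg (mul_nonneg (by linarith) (by linarith)) ht0.le),
      div_le_iff₀ ht0]
    nlinarith

lemma tendsto_lowCutDeriv {t : ℝ} (ht : 0 < t) :
    Tendsto (fun ε => lowCutDeriv ε t) (𝓝 0) (𝓝 1) := by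
  have h1 : Continuous fun ε => lowCutDeriv ε t := by
    unfold lowCutDeriv; fun_prop
  have h2 : lowCutDeriv 0 t = 1 := by
    rw [lowCutDeriv, sub_zero, max_eq_left ht.le]
    field_simp
    ring
  simpa [h2] using h1.tendsto 0

section BallCut

variable {E : Type*} [NormedAddCommGroup E]

/-- A continuously differentiable cutoff function supported in the ball of radius `R`. -/
def ballCut (R : ℝ) (x : E) : ℝ := max (1 - ‖x‖ ^ 2 / R ^ 2) 0 ^ 2

lemma continuous_ballCut (R : ℝ) : Continuous (ballCut R : E → ℝ) := by
  unfold ballCut; fun_prop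

lemma abs_ballCut_le (R : ℝ) (x : E) : |ballCut R x| ≤ 1 := by
  have h : 0 ≤ ‖x‖ ^ 2 / R ^ 2 := by positivity
  rw [ballCut, abs_of_nonneg (sq_nonneg _)]
  exact pow_le_one₀ (le_max_right _ _) (max_le (by linarith) zero_le_one)

lemma max_sub_eq_zero {R : ℝ} (hR : 0 < R) {x : E} (hx : R ≤ ‖x‖) :
    max (1 - ‖x‖ ^ 2 / R ^ 2) 0 = 0 := by
  refine max_eq_right (sub_nonpos.2 ((one_le_div (by positivity)).2 ?_))
  gcongr

lemma tendsto_ballCut (x : E) : Tendsto (fun R => ballCut R x) atTop (𝓝 1) := by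
  have h1 : Tendsto (fun R : ℝ => ‖x‖ ^ 2 / R ^ 2) atTop (𝓝 0) :=
    tendsto_const_nhds.div_atTop (tendsto_pow_atTop two_ne_zero)
  have h2 := (((h1.const_sub 1).max (tendsto_const_nhds (x := (0 : ℝ)))).pow 2)
  simpa [ballCut] using h2

variable [InnerProductSpace ℝ E]

lemma hasCompactSupport_ballCut [FiniteDimensional ℝ E] {R : ℝ} (hR : 0 < R) :
    HasCompactSupport (ballCut R : E → ℝ) := by
  refine HasCompactSupport.intro (isCompact_closedBall (0 : E) R) fun x hx => ?_
  rw [mem_closedBall_zero_iff, not_le] at hx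
  simp [ballCut, max_sub_eq_zero hR hx.le]

/-- The derivative of `ballCut R` in direction `v`. -/
def ballCutDeriv (R : ℝ) (v x : E) : ℝ :=
  2 * max (1 - ‖x‖ ^ 2 / R ^ 2) 0 * -(2 * inner ℝ x v / R ^ 2)

lemma hasLineDerivAt_ballCut (R : ℝ) (v x : E) :
    HasLineDerivAt ℝ (ballCut R) (ballCutDeriv R v x) x v := by
  have h1 : HasDerivAt (fun t : ℝ => x + t • v) v 0 := by
    simpa using ((hasDerivAt_id (0 : ℝ)).smul_const v).const_add x
  have h2 := ((h1.norm_sq).div_const (R ^ 2)).const_sub 1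
  have h3 := HasDerivAt.comp (h₂ := fun s : ℝ => max s 0 ^ 2) (0 : ℝ)
    (hasDerivAt_max_zero_sq _) h2
  rw [zero_smul, add_zero] at h3
  exact h3

lemma continuous_ballCutDeriv (R : ℝ) (v : E) : Continuous (ballCutDeriv R v) := by
  unfold ballCutDeriv; fun_prop

lemma abs_ballCutDeriv_le {R : ℝ} (hR : 0 < R) (v x : E) :
    |ballCutDeriv R v x| ≤ 4 * ‖v‖ / R := by
  rcases le_or_gt R ‖x‖ with h | h
  · rw [ballCutDeriv, max_sub_eq_zero hR h]
    simp only [mul_zero, zero_mul, abs_zero]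
    positivity
  · have h0 : 0 ≤ ‖x‖ ^ 2 / R ^ 2 := by positivity
    have h1 : |max (1 - ‖x‖ ^ 2 / R ^ 2) 0| ≤ 1 := by
      rw [abs_of_nonneg (le_max_right _ _)]
      exact max_le (by linarith) zero_le_one
    have h2 : |inner ℝ x v| ≤ R * ‖v‖ :=
      (abs_real_inner_le_norm x v).trans (by gcongr)
    rw [ballCutDeriv, abs_mul, abs_mul, abs_neg, abs_div, abs_mul, abs_two,
      abs_of_pos (by positivity : 0 < R ^ 2)]
    calc 2 * |max (1 - ‖x‖ ^ 2 / R ^ 2) 0| * (2 * |inner ℝ x v| / R ^ 2)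
        ≤ 2 * 1 * (2 * (R * ‖v‖) / R ^ 2) := by gcongr
      _ = 4 * ‖v‖ / R := by field_simp; ring

end BallCut

/-! ### Stein's identity -/

section Stein

variable {d : ℕ} {X : Set (EuclideanSpace ℝ (Fin d))} {p : EuclideanSpace ℝ (Fin d) → ℝ}

lemma IsDensityOn.nonneg (hp : IsDensityOn X p) (x : EuclideanSpace ℝ (Fin d)) : 0 ≤ p x := by
  by_cases hx : x ∈ X
  · exact (hp.pos x hx).le
  · exact (hp.eq_zero x hx).ge

lemma IsDensityOn.integrable (hp : IsDensityOn X p) : Integrable p :=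
  .of_integral_ne_zero (by rw [hp.integral_eq_one]; exact one_ne_zero)

lemma IsDensityOn.hasLineDerivAt (hp : IsDensityOn X p) (hX : IsOpen X)
    {x : EuclideanSpace ℝ (Fin d)} (hx : x ∈ X) (v : EuclideanSpace ℝ (Fin d)) :
    HasLineDerivAt ℝ p (lineDeriv ℝ p x v) x v :=
  ((hp.differentiableOn.differentiableAt (hX.mem_nhds hx)).lineDifferentiableAt).hasLineDerivAt

lemma IsDensityOn.hasLineDerivAt_log (hp : IsDensityOn X p) (hX : IsOpen X)
    {x : EuclideanSpace ℝ (Fin d)} (hx : x ∈ X) (v : EuclideanSpace ℝ (Fin d)) :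
    HasLineDerivAt ℝ (fun y => Real.log (p y)) (lineDeriv ℝ p x v / p x) x v := by
  have h := HasDerivAt.log (hp.hasLineDerivAt hX hx v) (by simpa using (hp.pos x hx).ne')
  rw [zero_smul, add_zero] at h
  exact h

/-- Stein's identity for the truncated field `lowCut ε p · ballCut R · g`, which is supported in
a compact subset of `X`. The derivative of `p` enters only through the integrand `G` of the
identity itself, so that its integrability suffices. -/
lemma IsDensityOn.integral_cutoff_eq_zero (hp : IsDensityOn X p) (hX : IsOpen X)
    {v : EuclideanSpace ℝ (Fin d)} {g g' G : EuclideanSpace ℝ (Fin d) → ℝ} (hg : Continuous g)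
    (hg' : Continuous g') (hgd : ∀ x, HasLineDerivAt ℝ g (g' x) x v) {M : ℝ}
    (hM : ∀ x, |g x| ≤ M)
    (hG : ∀ x, G x = p x * (lineDeriv ℝ (fun y => Real.log (p y)) x v * g x + g' x))
    (hGi : Integrable G) {ε R : ℝ} (hε : 0 < ε) (hR : 0 < R) :
    Integrable (fun x => lowCutDeriv ε (p x) * ballCut R x * G x) ∧
    Integrable (fun x => (lowCut ε (p x) - p x * lowCutDeriv ε (p x)) * (ballCut R x * g' x)) ∧
    Integrable (fun x => lowCut ε (p x) * (ballCutDeriv R v x * g x)) ∧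
    (∫ x, lowCutDeriv ε (p x) * ballCut R x * G x)
      + (∫ x, (lowCut ε (p x) - p x * lowCutDeriv ε (p x)) * (ballCut R x * g' x))
      + ∫ x, lowCut ε (p x) * (ballCutDeriv R v x * g x) = 0 := by
  have hpm : Measurable p := hp.continuous.measurable
  have hl : Measurable fun x => lowCut ε (p x) := (measurable_lowCut ε).comp hpm
  have hl' : Measurable fun x => lowCutDeriv ε (p x) := (measurable_lowCutDeriv ε).comp hpm
  have hc := continuous_ballCut (E := EuclideanSpace ℝ (Fin d)) R
  have hc' := continuous_ballCutDeriv R v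
  have hM0 : 0 ≤ M := (abs_nonneg _).trans (hM 0)
  have i1 : Integrable (fun x => lowCutDeriv ε (p x) * ballCut R x * G x) := by
    refine hGi.bdd_mul (c := 1) (hl'.mul hc.measurable).aestronglyMeasurable
      (Eventually.of_forall fun x => ?_)
    rw [Real.norm_eq_abs, abs_mul]
    exact mul_le_one₀ (abs_lowCutDeriv_le hε) (abs_nonneg _) (abs_ballCut_le R x)
  have i2 : Integrable
      (fun x => (lowCut ε (p x) - p x * lowCutDeriv ε (p x)) * (ballCut R x * g' x)) := by
    refine Integrable.bdd_mul (c := 2 * ε) ?_ (hl.sub (hpm.mul hl')).aestronglyMeasurable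
      (Eventually.of_forall fun x => abs_lowCut_sub_le hε)
    exact (hc.mul hg').integrable_of_hasCompactSupport (hasCompactSupport_ballCut hR).mul_right
  have i3 : Integrable (fun x => lowCut ε (p x) * (ballCutDeriv R v x * g x)) := by
    refine (hp.integrable.mul_const (4 * ‖v‖ / R * M)).mono'
      (hl.mul (hc'.mul hg).measurable).aestronglyMeasurable (Eventually.of_forall fun x => ?_)
    rw [Real.norm_eq_abs, abs_mul, abs_mul]
    exact mul_le_mul (abs_lowCut_le hε (hp.nonneg x))
      (mul_le_mul (abs_ballCutDeriv_le hR v x) (hM x) (abs_nonneg _) (by positivity))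
      (by positivity) (hp.nonneg x)
  refine ⟨i1, i2, i3, ?_⟩
  have iw : Integrable fun x => lowCut ε (p x) * (ballCut R x * g x) := by
    refine (hp.integrable.mul_const (1 * M)).mono'
      (hl.mul (hc.mul hg).measurable).aestronglyMeasurable (Eventually.of_forall fun x => ?_)
    rw [Real.norm_eq_abs, abs_mul, abs_mul]
    exact mul_le_mul (abs_lowCut_le hε (hp.nonneg x))
      (mul_le_mul (abs_ballCut_le R x) (hM x) (abs_nonneg _) zero_le_one)
      (by positivity) (hp.nonneg x)
  have hw : ∀ x, HasLineDerivAt ℝ (fun x => lowCut ε (p x) * (ballCut R x * g x))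
      (lowCutDeriv ε (p x) * ballCut R x * G x
        + (lowCut ε (p x) - p x * lowCutDeriv ε (p x)) * (ballCut R x * g' x)
        + lowCut ε (p x) * (ballCutDeriv R v x * g x)) x v := by
    intro x
    by_cases hx : x ∈ X
    · have h1 : HasDerivAt (fun t : ℝ => lowCut ε (p (x + t • v)))
          (lowCutDeriv ε (p x) * lineDeriv ℝ p x v) 0 :=
        HasDerivAt.comp (h₂ := lowCut ε) (h := fun t : ℝ => p (x + t • v)) (0 : ℝ)
          (by simpa using hasDerivAt_lowCut ε (hp.pos x hx)) (hp.hasLineDerivAt hX hx v)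
      have h2 := h1.mul (HasDerivAt.mul (hasLineDerivAt_ballCut R v x) (hgd x))
      refine HasDerivAt.congr_deriv h2 ?_
      rw [hG, (hp.hasLineDerivAt_log hX hx v).lineDeriv]
      have := (hp.pos x hx).ne'
      simp only [Pi.mul_apply, zero_smul, add_zero]
      field_simp
      ring
    · have hpx : p x = 0 := hp.eq_zero x hx
      have h1 : (fun x => lowCut ε (p x) * (ballCut R x * g x)) =ᶠ[𝓝 x] fun _ => 0 := by
        filter_upwards [hp.continuous.continuousAt.eventually_lt_const (hpx.trans_lt hε)]
          with y hy
        rw [lowCut_eq_zero hy.le, zero_mul]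
      rw [h1.hasLineDerivAt_iff, hpx, lowCut_eq_zero hε.le, lowCutDeriv_eq_zero hε.le]
      simpa [HasLineDerivAt] using hasDerivAt_const (0 : ℝ) (0 : ℝ)
  have h := integral_bilinear_hasLineDerivAt_right_eq_neg_left_of_integrable
    (μ := (volume : Measure (EuclideanSpace ℝ (Fin d)))) (B := ContinuousLinearMap.mul ℝ ℝ)
    (f := fun _ => (1 : ℝ)) (f' := fun _ => 0) (v := v)
    (g := fun x => lowCut ε (p x) * (ballCut R x * g x))
    (g' := fun x => lowCutDeriv ε (p x) * ballCut R x * G x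
        + (lowCut ε (p x) - p x * lowCutDeriv ε (p x)) * (ballCut R x * g' x)
        + lowCut ε (p x) * (ballCutDeriv R v x * g x))
    (by simp) (by simp only [ContinuousLinearMap.mul_apply', one_mul]; exact (i1.add i2).add i3)
    (by simpa using iw)
    (fun x _ => hasDerivAt_const _ _) (fun x _ => hw x)
  simp only [ContinuousLinearMap.mul_apply', one_mul, zero_mul, integral_zero, neg_zero] at h
  have h12 := integral_add (i1.add i2) i3
  simp only [Pi.add_apply] at h12
  rw [← integral_add i1 i2, ← h12, h]

/-- Stein's identity in one direction `v`, under the sole assumption that its integrand is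
integrable: nothing is assumed on the boundary of `X` or on the derivative of `p`. -/
lemma IsDensityOn.integral_stein_eq_zero (hp : IsDensityOn X p) (hX : IsOpen X)
    {v : EuclideanSpace ℝ (Fin d)} {g g' : EuclideanSpace ℝ (Fin d) → ℝ} (hg : Continuous g)
    (hg' : Continuous g') (hgd : ∀ x, HasLineDerivAt ℝ g (g' x) x v) {M : ℝ}
    (hM : ∀ x, |g x| ≤ M)
    (hGi : Integrable
      fun x => p x * (lineDeriv ℝ (fun y => Real.log (p y)) x v * g x + g' x)) :
    ∫ x, p x * (lineDeriv ℝ (fun y => Real.log (p y)) x v * g x + g' x) = 0 := by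
  set G : EuclideanSpace ℝ (Fin d) → ℝ :=
    fun x => p x * (lineDeriv ℝ (fun y => Real.log (p y)) x v * g x + g' x) with hG
  have hM0 : 0 ≤ M := (abs_nonneg _).trans (hM 0)
  have hG0 : ∀ x ∉ X, G x = 0 := fun x hx => by simp [hG, hp.eq_zero x hx]
  -- Bounds for the two error terms, of order `ε` and `1 / R`.
  have hbound : ∀ R > 0, ∀ ε > 0, |∫ x, lowCutDeriv ε (p x) * ballCut R x * G x| ≤
      2 * ε * (∫ x, |ballCut R x * g' x|) + 4 * ‖v‖ / R * M := by
    intro R hR ε hε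
    obtain ⟨-, i2, i3, h⟩ := hp.integral_cutoff_eq_zero hX hg hg' hgd hM (fun _ => rfl) hGi hε hR
    have ic : Integrable fun x => ballCut R x * g' x :=
      ((continuous_ballCut R).mul hg').integrable_of_hasCompactSupport
        (hasCompactSupport_ballCut hR).mul_right
    have b2 : |∫ x, (lowCut ε (p x) - p x * lowCutDeriv ε (p x)) * (ballCut R x * g' x)| ≤
        2 * ε * ∫ x, |ballCut R x * g' x| := by
      rw [← integral_const_mul]
      refine norm_integral_le_of_norm_le (G := ℝ) (ic.abs.const_mul _)
        (Eventually.of_forall fun x => ?_)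
      rw [Real.norm_eq_abs, abs_mul]
      exact mul_le_mul_of_nonneg_right (abs_lowCut_sub_le hε) (abs_nonneg _)
    have b3 : |∫ x, lowCut ε (p x) * (ballCutDeriv R v x * g x)| ≤ 4 * ‖v‖ / R * M := by
      have : 4 * ‖v‖ / R * M = ∫ x, p x * (4 * ‖v‖ / R * M) := by
        rw [integral_mul_const, hp.integral_eq_one, one_mul]
      rw [this]
      refine norm_integral_le_of_norm_le (G := ℝ) (hp.integrable.mul_const _)
        (Eventually.of_forall fun x => ?_)
      rw [Real.norm_eq_abs, abs_mul, abs_mul]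
      exact mul_le_mul (abs_lowCut_le hε (hp.nonneg x))
        (mul_le_mul (abs_ballCutDeriv_le hR v x) (hM x) (abs_nonneg _) (by positivity))
        (by positivity) (hp.nonneg x)
    rw [abs_le] at b2 b3 ⊢
    constructor <;> linarith [b2.1, b2.2, b3.1, b3.2]
  have hR : ∀ R > 0, |∫ x, ballCut R x * G x| ≤ 4 * ‖v‖ / R * M := by
    intro R hR
    have t1 : Tendsto (fun ε => ∫ x, lowCutDeriv ε (p x) * ballCut R x * G x) (𝓝[>] 0)
        (𝓝 (∫ x, ballCut R x * G x)) := by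
      refine tendsto_integral_filter_of_dominated_convergence (fun x => |G x|) ?_ ?_ hGi.abs ?_
      · filter_upwards [self_mem_nhdsWithin] with ε hε
        exact (hp.integral_cutoff_eq_zero hX hg hg' hgd hM (fun _ => rfl) hGi hε hR).1.1
      · filter_upwards [self_mem_nhdsWithin] with ε hε
        refine Eventually.of_forall fun x => ?_
        rw [Real.norm_eq_abs, abs_mul, abs_mul]
        exact mul_le_of_le_one_left (abs_nonneg _)
          (mul_le_one₀ (abs_lowCutDeriv_le hε) (abs_nonneg _) (abs_ballCut_le R x))
      · refine Eventually.of_forall fun x => ?_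
        by_cases hx : x ∈ X
        · have : Tendsto (fun ε => lowCutDeriv ε (p x)) (𝓝[>] 0) (𝓝 1) :=
            (tendsto_lowCutDeriv (hp.pos x hx)).mono_left nhdsWithin_le_nhds
          simpa using (this.mul_const (ballCut R x)).mul_const (G x)
        · simp [hG0 x hx]
    have t2 : Tendsto (fun ε : ℝ => 2 * ε * (∫ x, |ballCut R x * g' x|) + 4 * ‖v‖ / R * M)
        (𝓝[>] 0) (𝓝 (4 * ‖v‖ / R * M)) := by
      have : Continuous fun ε : ℝ =>
          2 * ε * (∫ x, |ballCut R x * g' x|) + 4 * ‖v‖ / R * M := by fun_prop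
      simpa using (this.tendsto 0).mono_left nhdsWithin_le_nhds
    refine le_of_tendsto_of_tendsto t1.abs t2 ?_
    filter_upwards [self_mem_nhdsWithin] with ε hε using hbound R hR ε hε
  have t1 : Tendsto (fun R => ∫ x, ballCut R x * G x) atTop (𝓝 (∫ x, G x)) := by
    refine tendsto_integral_filter_of_dominated_convergence (fun x => |G x|) ?_ ?_ hGi.abs ?_
    · exact Eventually.of_forall fun R =>
        (continuous_ballCut R).aestronglyMeasurable.mul hGi.1
    · refine Eventually.of_forall fun R => Eventually.of_forall fun x => ?_
      rw [Real.norm_eq_abs, abs_mul]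
      exact mul_le_of_le_one_left (abs_nonneg _) (abs_ballCut_le R x)
    · refine Eventually.of_forall fun x => ?_
      simpa using (tendsto_ballCut x).mul_const (G x)
  have t2 : Tendsto (fun R : ℝ => 4 * ‖v‖ / R * M) atTop (𝓝 0) := by
    simpa using (tendsto_const_nhds.div_atTop tendsto_id).mul_const M
  have h0 : |∫ x, G x| ≤ 0 := by
    refine le_of_tendsto_of_tendsto t1.abs t2 ?_
    filter_upwards [eventually_gt_atTop 0] with R hR0 using hR R hR0
  exact abs_nonpos_iff.1 h0

end Stein

/-! ### Functions with almost everywhere vanishing derivative -/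

/-- A function that is differentiable at every point of an open set and whose derivative
vanishes almost everywhere has zero derivative everywhere. -/
lemma fderiv_eq_zero_of_ae {E : Type*} [NormedAddCommGroup E] [NormedSpace ℝ E]
    [FiniteDimensional ℝ E] [MeasurableSpace E] [BorelSpace E] {μ : Measure E}
    [μ.IsAddHaarMeasure] {X : Set E} (hX : IsOpen X) {u : E → ℝ} (hu : DifferentiableOn ℝ u X)
    (h0 : ∀ᵐ x ∂μ, x ∈ X → fderiv ℝ u x = 0) {x : E} (hx : x ∈ X) : fderiv ℝ u x = 0 := by
  obtain ⟨r, hr, hrX⟩ := Metric.isOpen_iff.1 hX x hx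
  have hd : ∀ y ∈ X, DifferentiableAt ℝ u y := fun y hy => hu.differentiableAt (hX.mem_nhds hy)
  suffices h : ∀ v : E, ‖v‖ < r / 2 → u (x + v) = u x by
    have h1 : u =ᶠ[𝓝 x] fun _ => u x := by
      filter_upwards [Metric.ball_mem_nhds x (half_pos hr)] with y hy
      have := h (y - x) (by rwa [Metric.mem_ball, dist_eq_norm] at hy)
      simpa using this
    rw [h1.fderiv_eq]
    simp
  intro v hv
  have hball : ∀ y ∈ Metric.ball x (r / 2), ∀ t ∈ Set.uIcc (0 : ℝ) 1, y + t • v ∈ X := by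
    intro y hy t ht
    rw [Set.uIcc_of_le zero_le_one] at ht
    refine hrX ?_
    rw [Metric.mem_ball, dist_eq_norm] at hy ⊢
    have h1 : ‖t • v‖ ≤ ‖v‖ := by
      rw [norm_smul, Real.norm_of_nonneg ht.1]
      nlinarith [ht.2, norm_nonneg v]
    have h2 : y + t • v - x = (y - x) + t • v := by abel
    rw [h2]
    linarith [norm_add_le (y - x) (t • v)]
  -- A measurable null set `N` off which the derivative vanishes.
  obtain ⟨N, hN, hNm, hN0⟩ := exists_measurable_superset_of_null (ae_iff.1 h0)
  have hshift : ∀ t : ℝ, ∀ᵐ y ∂μ, y + t • v ∉ N := fun t =>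
    (measurePreserving_add_right μ (t • v)).quasiMeasurePreserving.ae
      (measure_eq_zero_iff_ae_notMem.1 hN0)
  have hline : ∀ᵐ y ∂μ, ∀ᵐ t : ℝ, y + t • v ∉ N := by
    have hm : MeasurableSet {z : ℝ × E | z.2 + z.1 • v ∉ N} :=
      (by fun_prop : Measurable fun z : ℝ × E => z.2 + z.1 • v) hNm.compl
    exact (Measure.ae_ae_comm hm).1 (Eventually.of_forall hshift)
  -- Along almost every segment parallel to `v` the fundamental theorem of calculus applies.
  have hae : (fun y => u (y + v)) =ᵐ[μ.restrict (Metric.ball x (r / 2))] u := by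
    refine (ae_restrict_iff' Metric.isOpen_ball.measurableSet).2 ?_
    filter_upwards [hline] with y hy hyb
    have hder : ∀ t ∈ Set.uIcc (0 : ℝ) 1,
        HasDerivAt (fun t : ℝ => u (y + t • v)) (fderiv ℝ u (y + t • v) v) t := by
      intro t ht
      have h1 : HasDerivAt (fun t : ℝ => y + t • v) ((1 : ℝ) • v) t :=
        ((hasDerivAt_id t).smul_const v).const_add y
      rw [one_smul] at h1
      exact (hd _ (hball y hyb t ht)).hasFDerivAt.comp_hasDerivAt t h1
    have hz : (fun t : ℝ => fderiv ℝ u (y + t • v) v)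
        =ᵐ[volume.restrict (Set.uIoc (0 : ℝ) 1)] fun _ => (0 : ℝ) := by
      refine (ae_restrict_iff' measurableSet_uIoc).2 ?_
      filter_upwards [hy] with t ht htI
      have h2 : fderiv ℝ u (y + t • v) = 0 := by
        by_contra hne
        exact ht (hN fun hc => hne (hc (hball y hyb t (Set.uIoc_subset_uIcc htI))))
      simp [h2]
    have hint : IntervalIntegrable (fun t : ℝ => fderiv ℝ u (y + t • v) v) volume 0 1 :=
      (intervalIntegrable_const (c := (0 : ℝ))).congr_ae hz.symm
    have h3 := intervalIntegral.integral_eq_sub_of_hasDerivAt hder hint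
    rw [intervalIntegral.integral_congr_ae_restrict hz] at h3
    simp only [intervalIntegral.integral_zero, one_smul, zero_smul, add_zero] at h3
    linarith
  have hcont : ContinuousOn (fun y => u (y + v)) (Metric.ball x (r / 2)) := by
    intro y hy
    have h1 : y + v ∈ X := by simpa using hball y hy 1 (by simp)
    exact (ContinuousAt.comp (f := fun y => y + v) (hd _ h1).continuousAt
      (by fun_prop)).continuousWithinAt
  have hcont' : ContinuousOn u (Metric.ball x (r / 2)) :=
    hu.continuousOn.mono fun y hy => by simpa using hball y hy 0 (by simp)
  exact Measure.eqOn_open_of_ae_eq hae Metric.isOpen_ball hcont hcont'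
    (Metric.mem_ball_self (half_pos hr))

/-! ### Orthogonality and density in `L²` -/

/-- A function that is orthogonal in `L²(μ)` to all elements of a `C₀`-universal space is zero. -/
lemma IsC0Universal.ae_eq_zero_of_integral_mul_eq_zero {d : ℕ} {F : Type*} [NormedAddCommGroup F]
    [InnerProductSpace ℝ F] [RKHS ℝ F (EuclideanSpace ℝ (Fin d)) ℝ]
    (hu : IsC0Universal (X := EuclideanSpace ℝ (Fin d)) F)
    {μ : Measure (EuclideanSpace ℝ (Fin d))} [IsProbabilityMeasure μ]
    {g : EuclideanSpace ℝ (Fin d) → ℝ} (hg : MemLp g 2 μ)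
    (hF : ∀ f : F, MemLp f 2 μ) (h : ∀ f : F, ∫ x, g x * f x ∂μ = 0) : g =ᵐ[μ] 0 := by
  rw [← eLpNorm_eq_zero_iff hg.1 two_ne_zero]
  refine le_antisymm (le_of_forall_pos_le_add fun ε hε => ?_) zero_le
  obtain ⟨f, hf⟩ := hu.dense μ inferInstance g hg ε hε
  rw [zero_add]
  refine le_trans ?_ hf.le
  -- By orthogonality `‖g - f‖² = ‖g‖² + ‖f‖²`, so approximation forces `‖g‖` to be small.
  have h1 : inner ℝ (hg.toLp g) ((hF f).toLp f) = 0 := by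
    rw [L2.inner_def, ← h f]
    refine integral_congr_ae ?_
    filter_upwards [hg.coeFn_toLp, (hF f).coeFn_toLp] with x h1 h2
    rw [h1, h2]
    simp [mul_comm]
  have h2 : ‖hg.toLp g‖ ≤ ‖hg.toLp g - (hF f).toLp f‖ := by
    refine le_of_sq_le_sq ?_ (norm_nonneg _)
    rw [@norm_sub_sq_real, h1]
    nlinarith [sq_nonneg ‖(hF f).toLp f‖]
  rw [← MemLp.toLp_sub, Lp.norm_toLp, Lp.norm_toLp] at h2
  exact (ENNReal.toReal_le_toReal hg.2.ne (hg.sub (hF f)).2.ne).1 h2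

/-! ### The law of a density -/

section Law

variable {d : ℕ} {X : Set (EuclideanSpace ℝ (Fin d))} {p : EuclideanSpace ℝ (Fin d) → ℝ}

lemma IsDensityOn.integral_law (hp : IsDensityOn X p) (f : EuclideanSpace ℝ (Fin d) → ℝ) :
    ∫ x, f x ∂(law p) = ∫ x, p x * f x := by
  rw [law, integral_withDensity_eq_integral_toReal_smul hp.continuous.measurable.ennreal_ofReal
    (Eventually.of_forall fun _ => ENNReal.ofReal_lt_top)]
  simp only [ENNReal.toReal_ofReal (hp.nonneg _), smul_eq_mul]

lemma IsDensityOn.integrable_law_iff (hp : IsDensityOn X p)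
    {f : EuclideanSpace ℝ (Fin d) → ℝ} :
    Integrable f (law p) ↔ Integrable fun x => p x * f x := by
  rw [law, integrable_withDensity_iff_integrable_smul' hp.continuous.measurable.ennreal_ofReal
    (Eventually.of_forall fun _ => ENNReal.ofReal_lt_top)]
  simp only [ENNReal.toReal_ofReal (hp.nonneg _), smul_eq_mul]

lemma IsDensityOn.isProbabilityMeasure_law (hp : IsDensityOn X p) :
    IsProbabilityMeasure (law p) := by
  refine ⟨?_⟩
  rw [law, withDensity_apply _ MeasurableSet.univ, Measure.restrict_univ,
    ← ofReal_integral_eq_lintegral_ofReal hp.integrable (Eventually.of_forall hp.nonneg),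
    hp.integral_eq_one, ENNReal.ofReal_one]

lemma IsDensityOn.ae_law_iff (hp : IsDensityOn X p) {P : EuclideanSpace ℝ (Fin d) → Prop} :
    (∀ᵐ x ∂(law p), P x) ↔ ∀ᵐ x, x ∈ X → P x := by
  rw [law, ae_withDensity_iff hp.continuous.measurable.ennreal_ofReal]
  refine eventually_congr (Eventually.of_forall fun x => ?_)
  by_cases hx : x ∈ X
  · simp [hx, hp.pos x hx]
  · simp [hx, hp.eq_zero x hx]

/-- Two densities on a connected open set whose logarithms have the same partial derivatives
almost everywhere are equal. -/
lemma IsDensityOn.eq_of_ae_lineDeriv_log_div_eq_zero {q : EuclideanSpace ℝ (Fin d) → ℝ}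
    (hX : IsOpen X) (hXc : IsConnected X) (hp : IsDensityOn X p) (hq : IsDensityOn X q)
    (h : ∀ i : Fin d, ∀ᵐ x, x ∈ X → partialDeriv i (fun y => Real.log (p y / q y)) x = 0) :
    p = q := by
  set u : EuclideanSpace ℝ (Fin d) → ℝ := fun y => Real.log (p y / q y) with hu
  have hud : DifferentiableOn ℝ u X := by
    simp only [hu, div_eq_mul_inv]
    exact (hp.differentiableOn.mul (hq.differentiableOn.inv fun x hx => (hq.pos x hx).ne')).log
      fun x hx => (mul_pos (hp.pos x hx) (inv_pos.2 (hq.pos x hx))).ne'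
  have h0 : ∀ᵐ x, x ∈ X → fderiv ℝ u x = 0 := by
    filter_upwards [ae_all_iff.2 h] with x hx hxX
    have hdx := hud.differentiableAt (hX.mem_nhds hxX)
    refine ContinuousLinearMap.coe_injective
      ((EuclideanSpace.basisFun (Fin d) ℝ).toBasis.ext fun i => ?_)
    have := hx i hxX
    rw [partialDeriv, hdx.lineDeriv_eq_fderiv] at this
    simpa using this
  obtain ⟨c, hc⟩ := hX.exists_is_const_of_fderiv_eq_zero hXc.isPreconnected hud
    fun x hx => fderiv_eq_zero_of_ae (μ := volume) hX hud h0 hx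
  have hpq : ∀ x, p x = Real.exp c * q x := by
    intro x
    by_cases hx : x ∈ X
    · rw [← hc x hx, hu, Real.exp_log (div_pos (hp.pos x hx) (hq.pos x hx)),
        div_mul_cancel₀ _ (hq.pos x hx).ne']
    · rw [hp.eq_zero x hx, hq.eq_zero x hx, mul_zero]
  have hc1 : Real.exp c = 1 := by
    have h1 := hp.integral_eq_one
    simp only [hpq] at h1
    rwa [integral_const_mul, hq.integral_eq_one, mul_one] at h1
  ext x
  rw [hpq, hc1, one_mul]

end Law

/-! ### The Stein operator on fields with one nonzero component -/

section SteinOp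

variable {d : ℕ} {F : Type*} [NormedAddCommGroup F] [InnerProductSpace ℝ F] [CompleteSpace F]
  [RKHS ℝ F (EuclideanSpace ℝ (Fin d)) ℝ] {X : Set (EuclideanSpace ℝ (Fin d))}
  {p q : EuclideanSpace ℝ (Fin d) → ℝ}

lemma steinOp_single (hk : IsC1Kernel (ker F)) (p : EuclideanSpace ℝ (Fin d) → ℝ) (i : Fin d)
    (f : F) (x : EuclideanSpace ℝ (Fin d)) :
    steinOp p (PiLp.single 2 i f) x =
      partialDeriv i (fun y => Real.log (p y)) x * f x + inner ℝ (derivFeature hk i x) f := by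
  rw [steinOp, Finset.sum_eq_single i]
  · rw [partialDeriv_coe hk]
    simp
  · intro j _ hj
    rw [partialDeriv_coe hk]
    simp [hj]
  · simp

/-- The expectation of the Stein operator under its own density vanishes. If the Stein operator
is not integrable, this holds because the Bochner integral is then zero by convention. -/
lemma integral_steinOp_single_self (hk : IsC1Kernel (ker F))
    (hu : IsC0Universal (X := EuclideanSpace ℝ (Fin d)) F) (hX : IsOpen X)
    (hp : IsDensityOn X p) (i : Fin d) (f : F) :
    ∫ x, steinOp p (PiLp.single 2 i f) x ∂(law p) = 0 := by
  by_cases hint : Integrable (fun x => steinOp p (PiLp.single 2 i f) x) (law p)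
  · rw [hp.integrable_law_iff] at hint
    rw [hp.integral_law]
    simp only [steinOp_single hk] at hint ⊢
    obtain ⟨M, hM⟩ := hu.exists_abs_le f
    exact hp.integral_stein_eq_zero hX (hu.continuous f)
      ((continuous_derivFeature hk i).inner continuous_const)
      (hasLineDerivAt_derivFeature hk i f) hM hint
  · exact integral_undef hint

lemma aestronglyMeasurable_partialDeriv_log (hX : IsOpen X) (hp : IsDensityOn X p)
    (i : Fin d) :
    AEStronglyMeasurable (partialDeriv i fun y => Real.log (p y)) (law p) := by
  have h : Measurable fun x => lineDeriv ℝ p x (EuclideanSpace.single i 1) / p x :=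
    (measurable_lineDeriv hp.continuous).div hp.continuous.measurable
  refine h.aestronglyMeasurable.congr (hp.ae_law_iff.2 (Eventually.of_forall fun x hx => ?_))
  exact (hp.hasLineDerivAt_log hX hx _).lineDeriv.symm

/-- Finiteness of `E h_q(Z, Z)` makes the Stein operator of `q` integrable under `q`. -/
lemma integrable_steinOp_single_self (hk : IsC1Kernel (ker F))
    (hu : IsC0Universal (X := EuclideanSpace ℝ (Fin d)) F) (hX : IsOpen X)
    (hq : IsDensityOn X q) (hh : Integrable (fun z => steinKernel (ker F) q z z) (law q))
    (i : Fin d) (f : F) :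
    Integrable (fun x => steinOp q (PiLp.single 2 i f) x) (law q) := by
  have := hq.isProbabilityMeasure_law
  simp only [steinOp_single hk]
  refine (((integrable_const (1 : ℝ)).add hh).const_mul ‖f‖).mono'
    (((aestronglyMeasurable_partialDeriv_log hX hq i).mul
      (hu.continuous f).aestronglyMeasurable).add
      ((continuous_derivFeature hk i).inner continuous_const).aestronglyMeasurable)
    (Eventually.of_forall fun x => ?_)
  set w : F := partialDeriv i (fun y => Real.log (q y)) x • feature F x + derivFeature hk i x
    with hw
  have h1 : partialDeriv i (fun y => Real.log (q y)) x * f x + inner ℝ (derivFeature hk i x) f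
      = inner ℝ w f := by
    rw [hw, inner_add_left, real_inner_smul_left, inner_feature]
  have h2 : ‖w‖ ^ 2 ≤ steinKernel (ker F) q x x := by
    rw [steinKernel_self hk]
    exact Finset.single_le_sum (f := fun j => ‖partialDeriv j (fun y => Real.log (q y)) x •
      feature F x + derivFeature hk j x‖ ^ 2) (fun j _ => sq_nonneg _) (Finset.mem_univ i)
  rw [h1]
  refine (norm_inner_le_norm w f).trans ?_
  rw [mul_comm]
  refine mul_le_mul_of_nonneg_left ?_ (norm_nonneg f)
  simp only [Pi.add_apply]
  nlinarith [sq_nonneg (‖w‖ - 1)]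

/-- If the Stein discrepancy is zero, then the Stein operator of `p` has zero expectation under
`q`. -/
lemma integral_steinOp_single_eq_zero (hk : IsC1Kernel (ker F))
    (hu : IsC0Universal (X := EuclideanSpace ℝ (Fin d)) F) (hX : IsOpen X)
    (hp : IsDensityOn X p) (hS : steinDiscrepancy F p q = 0) (i : Fin d) (f : F) :
    ∫ x, steinOp p (PiLp.single 2 i f) x ∂(law q) = 0 := by
  have hle : ∀ g : F, ‖g‖ < 1 → ∫ x, steinOp p (PiLp.single 2 i g) x ∂(law q) ≤ 0 := by
    intro g hg
    have hmem : (PiLp.single 2 i g : PiLp 2 fun _ : Fin d => F) ∈ Metric.ball 0 1 := by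
      rwa [mem_ball_zero_iff, PiLp.norm_single]
    have h1 : (((∫ z, steinOp p (PiLp.single 2 i g) z ∂(law q))
        - ∫ x, steinOp p (PiLp.single 2 i g) x ∂(law p) : ℝ) : EReal) ≤
        steinDiscrepancy F p q :=
      le_iSup₂ (f := fun (f : PiLp 2 fun _ : Fin d => F) (_ : f ∈ Metric.ball 0 1) =>
        (((∫ z, steinOp p f z ∂(law q)) - ∫ x, steinOp p f x ∂(law p) : ℝ) : EReal)) _ hmem
    rw [hS, integral_steinOp_single_self hk hu hX hp, sub_zero] at h1
    exact_mod_cast h1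
  have hsmul : ∀ c : ℝ, ∫ x, steinOp p (PiLp.single 2 i (c • f)) x ∂(law q) =
      c * ∫ x, steinOp p (PiLp.single 2 i f) x ∂(law q) := by
    intro c
    rw [← integral_const_mul]
    congr 1
    ext x
    simp only [steinOp_single hk, RKHS.coe_smul, Pi.smul_apply, inner_smul_right, smul_eq_mul]
    ring
  set c : ℝ := (‖f‖ + 1)⁻¹ with hc
  have hc0 : 0 < c := by positivity
  have hcf : ‖c • f‖ < 1 := by
    rw [norm_smul, Real.norm_of_nonneg hc0.le, hc, inv_mul_lt_one₀ (by positivity)]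
    linarith
  have h1 := hle (c • f) hcf
  have h2 := hle ((-c) • f) (by rwa [neg_smul, norm_neg])
  rw [hsmul] at h1 h2
  have h3 : c * ∫ x, steinOp p (PiLp.single 2 i f) x ∂(law q) = 0 := by linarith
  exact (mul_eq_zero.1 h3).resolve_left hc0.ne'

lemma partialDeriv_log_div (hX : IsOpen X) (hp : IsDensityOn X p) (hq : IsDensityOn X q)
    (i : Fin d) {x : EuclideanSpace ℝ (Fin d)} (hx : x ∈ X) :
    partialDeriv i (fun y => Real.log (p y / q y)) x =
      partialDeriv i (fun y => Real.log (p y)) x - partialDeriv i (fun y => Real.log (q y)) x := by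
  have h1 : (fun y => Real.log (p y / q y)) =ᶠ[𝓝 x] fun y => Real.log (p y) - Real.log (q y) := by
    filter_upwards [hX.mem_nhds hx] with y hy
    rw [Real.log_div (hp.pos y hy).ne' (hq.pos y hy).ne']
  have h2 := hp.hasLineDerivAt_log hX hx (EuclideanSpace.single i 1)
  have h3 := hq.hasLineDerivAt_log hX hx (EuclideanSpace.single i 1)
  have h4 : HasLineDerivAt ℝ (fun y => Real.log (p y) - Real.log (q y)) _ x
    (EuclideanSpace.single i 1) := HasDerivAt.sub h2 h3
  rw [partialDeriv, h1.lineDeriv_eq, h4.lineDeriv, partialDeriv, partialDeriv, h2.lineDeriv,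
    h3.lineDeriv]

lemma memLp_partialDeriv_log_div (hX : IsOpen X) (hp : IsDensityOn X p) (hq : IsDensityOn X q)
    (hg : Integrable (fun z => ‖grad (fun y => Real.log (p y / q y)) z‖ ^ 2) (law q))
    (i : Fin d) : MemLp (partialDeriv i fun y => Real.log (p y / q y)) 2 (law q) := by
  have hm : AEStronglyMeasurable (partialDeriv i fun y => Real.log (p y / q y)) (law q) := by
    have h : Measurable fun x => lineDeriv ℝ p x (EuclideanSpace.single i 1) / p x
        - lineDeriv ℝ q x (EuclideanSpace.single i 1) / q x :=
      ((measurable_lineDeriv hp.continuous).div hp.continuous.measurable).sub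
        ((measurable_lineDeriv hq.continuous).div hq.continuous.measurable)
    refine h.aestronglyMeasurable.congr (hq.ae_law_iff.2 (Eventually.of_forall fun x hx => ?_))
    rw [partialDeriv_log_div hX hp hq i hx, partialDeriv, partialDeriv,
      (hp.hasLineDerivAt_log hX hx _).lineDeriv, (hq.hasLineDerivAt_log hX hx _).lineDeriv]
  rw [memLp_two_iff_integrable_sq hm]
  refine hg.mono' (hm.pow 2) (Eventually.of_forall fun x => ?_)
  rw [Real.norm_of_nonneg (sq_nonneg _), EuclideanSpace.norm_sq_eq]
  have := Finset.single_le_sum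
    (f := fun j => ‖grad (fun y => Real.log (p y / q y)) x j‖ ^ 2)
    (fun j _ => sq_nonneg _) (Finset.mem_univ i)
  simpa [grad] using this

/-- If the Stein discrepancy is zero, then `∂ᵢ log (p / q)` is orthogonal to `F` in `L²(q)`. -/
lemma integral_partialDeriv_log_div_mul_eq_zero (hk : IsC1Kernel (ker F))
    (hu : IsC0Universal (X := EuclideanSpace ℝ (Fin d)) F) (hX : IsOpen X)
    (hp : IsDensityOn X p) (hq : IsDensityOn X q)
    (hh : Integrable (fun z => steinKernel (ker F) q z z) (law q))
    (hg : Integrable (fun z => ‖grad (fun y => Real.log (p y / q y)) z‖ ^ 2) (law q))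
    (hS : steinDiscrepancy F p q = 0) (i : Fin d) (f : F) :
    ∫ x, partialDeriv i (fun y => Real.log (p y / q y)) x * f x ∂(law q) = 0 := by
  have := hq.isProbabilityMeasure_law
  obtain ⟨M, hM⟩ := hu.exists_abs_le f
  have i1 : Integrable (fun x => partialDeriv i (fun y => Real.log (p y / q y)) x * f x)
      (law q) :=
    ((memLp_partialDeriv_log_div hX hp hq hg i).integrable one_le_two).mul_bdd (c := M)
      (hu.continuous f).aestronglyMeasurable (Eventually.of_forall hM)
  have i2 := integrable_steinOp_single_self hk hu hX hq hh i f
  have h1 : ∫ x, steinOp p (PiLp.single 2 i f) x ∂(law q) =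
      ∫ x, partialDeriv i (fun y => Real.log (p y / q y)) x * f x
        + steinOp q (PiLp.single 2 i f) x ∂(law q) := by
    refine integral_congr_ae (hq.ae_law_iff.2 (Eventually.of_forall fun x hx => ?_))
    simp only [steinOp_single hk, partialDeriv_log_div hX hp hq i hx]
    ring
  rwa [integral_steinOp_single_eq_zero hk hu hX hp hS, integral_add i1 i2,
    integral_steinOp_single_self hk hu hX hq, add_zero, eq_comm] at h1

end SteinOp

end

end KernelStein

theorem theorem2 {d : ℕ} (X : Set (EuclideanSpace ℝ (Fin d))) (hX : IsOpen X)
    (hXc : IsConnected X) (p q : EuclideanSpace ℝ (Fin d) → ℝ)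
    (hp : KernelStein.IsDensityOn X p) (hq : KernelStein.IsDensityOn X q)
    {F : Type*} [NormedAddCommGroup F] [InnerProductSpace ℝ F] [CompleteSpace F]
    [RKHS ℝ F (EuclideanSpace ℝ (Fin d)) ℝ]
    (hk : KernelStein.IsC1Kernel (KernelStein.ker F))
    (hu : KernelStein.IsC0Universal F)
    (hh : Integrable (fun z => KernelStein.steinKernel (KernelStein.ker F) q z z)
      (KernelStein.law q))
    (hg : Integrable (fun z => ‖KernelStein.grad (fun y => Real.log (p y / q y)) z‖ ^ 2)
      (KernelStein.law q)) :
    KernelStein.steinDiscrepancy F p q = 0 ↔ p = q := by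
  have hprob := hq.isProbabilityMeasure_law
  constructor
  · intro hS
    refine KernelStein.IsDensityOn.eq_of_ae_lineDeriv_log_div_eq_zero hX hXc hp hq fun i => ?_
    refine hq.ae_law_iff.1 (hu.ae_eq_zero_of_integral_mul_eq_zero
      (KernelStein.memLp_partialDeriv_log_div hX hp hq hg i) (fun f => ?_)
      (KernelStein.integral_partialDeriv_log_div_mul_eq_zero hk hu hX hp hq hh hg hS i))
    obtain ⟨M, hM⟩ := hu.exists_abs_le f
    exact MemLp.of_bound (hu.continuous f).aestronglyMeasurable M (Eventually.of_forall hM)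
  · rintro rfl
    simp only [KernelStein.steinDiscrepancy, sub_self, EReal.coe_zero]
    exact biSup_const ⟨0, Metric.mem_ball_self one_pos⟩
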